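/- Let $d\ge 0$, let $b:\mathbb{R}^d\to\mathbb{R}^d$ be locally Lipschitz and $\sigma>0$. Let $\Omega=C(\mathbb{R};\mathbb{R}^d)$ with its Borel $\sigma$-field, let $\mathbb{P}$ be the two-sided Wiener measure on $\Omega$, $W_t(\omega)=\omega(t)$, and $(\theta_t\omega)(s)=\omega(s+t)-\omega(t)$. Let $\varphi$ be the (in general local) random dynamical system over $\theta$ associated to $$dX_t=b(X_t)\,dt+\sigma\,dW_t ,$$ that is: $\varphi:\mathbb{R}_+\times\Omega\times\mathbb{R}^d\to\mathbb{R}^d\cup\{\partial\}$ is measurable; $D(\omega)=\{(t,x):\varphi_t(\omega,x)\neq\partial\}$ is open in $\mathbb{R}_+\times\mathbb{R}^d$, and $(t,x)\in D(\omega)$, $0\le s\le t$ imply $(s,x)\in D(\omega)$; $\varphi_t(\omega,\cdot)$ is continuous at every $x$ with $\varphi_t(\omega,x)\ne\partial$; $\varphi_0(\omega,x)=x$ and $\varphi_{t+s}(\omega,x)=\varphi_t(\theta_s\omega,\varphi_s(\omega,x))$ for all $s,t,\omega,x$ (with $\varphi_t(\omega,\partial)=\partial$); and almost surely, for every $x$,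 the path $t\mapsto\varphi_t(\omega,x)$ is continuous and satisfies $\varphi_t=x+\int_0^t b(\varphi_s)\,ds+\sigma(W_t-W_0)$ as long as it is not $\partial$, and it is unbounded on its lifetime if it reaches $\partial$ in finite time. (If $\varphi$ never takes the value $\partial$, it is a random dynamical system in the usual, global sense; such a $\varphi$ exists if in addition $(b(x)-b(y),x-y)\le\lambda|x-y|^2$ for all $x,y$ and some $\lambda>0$.) Write $B(x,r)$ for the open ball of radius $r$ around $x$. Then: 1. For every ball $B(x,r)$ with $r>0$, every $\delta>0$ and every $z\in\mathbb{R}^d$ there is $T_0>0$ such that for all $t_0\in(0,T_0]$ $$\mathbb{P}\big(\varphi_{t_0}(\cdot,x')\in B(x'+z,\delta)\ \text{ for all } x'\in B(x,r)\big)>0 .$$ 2. In particular $\varphi$ is swift transitive: for every ball $B(x,r)$ with $r>0$ and every $y\in\mathbb{R}^d$ there is $t>0$ with $\mathbb{P}\big(\varphi_t(\cdot,B(x,r))\subseteq B(y,2r)\big)>0$. 3. If in addition $b$ is monotone on large sets, i.e. for each $r>0$ there is $z\in\mathbb{R}^d$ with $(b(x)-b(y),x-y)<0$ for all $x\ne y$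 in $B(z,r)$, then $\varphi$ is contracting on large sets: for every $R>0$ there are a ball $B(y,R)$ and a time $t>0$ such that $$\mathbb{P}\big(\varphi_t(\cdot,B(y,R))\subseteq\mathbb{R}^d\ \text{ and }\ \operatorname{diam}\varphi_t(\cdot,B(y,R))\le R/4\big)>0 .$$ -/

import Mathlib

open MeasureTheory ProbabilityTheory Set Filter Topology
open scoped NNReal

/-- The state space `ℝ^d` with its Euclidean norm. -/
abbrev State (d : ℕ) : Type := EuclideanSpace ℝ (Fin d)

/-- The canonical sample space `Ω = C(ℝ, ℝ^d)` of two-sided noise paths, with the topology of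
locally uniform convergence (the compact-open topology). -/
abbrev PathSpace (d : ℕ) : Type := C(ℝ, State d)

/-- The (not completed) Borel `σ`-field on the path space. -/
instance pathSpaceMeasurableSpace (d : ℕ) : MeasurableSpace (PathSpace d) := borel _

instance pathSpaceBorelSpace (d : ℕ) : BorelSpace (PathSpace d) := ⟨rfl⟩

/-- `P` is the two-sided Wiener measure on `C(ℝ, ℝ^d)`: under `P`, the coordinate process
`W_t(ω) = ω(t)`, `t ∈ ℝ`, starts at `0`, has independent increments, and `W_t - W_s` has the law
`N(0, (t - s) Id)` for all `s ≤ t`. These properties determine `P`. -/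
structure IsWienerMeasure {d : ℕ} (P : Measure (PathSpace d)) : Prop where
  isProbabilityMeasure : IsProbabilityMeasure P
  start_zero : ∀ᵐ ω ∂P, ω 0 = 0
  indep_increments : HasIndepIncrements (fun (t : ℝ) (ω : PathSpace d) => ω t) P
  law_increments : ∀ s t : ℝ, s ≤ t →
    HasLaw (fun ω : PathSpace d => ω t - ω s)
      ((stdGaussian (State d)).map (fun x => Real.sqrt (t - s) • x)) P

/-- The Wiener shift `(θ_t ω)(s) = ω(s + t) - ω(t)`. -/
def wienerShift {d : ℕ} (t : ℝ) (ω : PathSpace d) : PathSpace d where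
  toFun s := ω (s + t) - ω t
  continuous_toFun := by fun_prop

/-- A (local) random dynamical system over the shifts `θ`. The value `none` of `Option E` is the
adjoined cemetery state `∂`, at which the system stays forever. A (global) random dynamical
system is the case in which `φ` never takes the value `none`. The set `D(ω)` of the definition is
`{(t, x) | φ_t(ω, x) ≠ ∂}`. -/
structure IsLocalRDS {Ω E : Type*} [MeasurableSpace Ω] [TopologicalSpace E] [MeasurableSpace E]
    (θ : ℝ → Ω → Ω) (φ : ℝ≥0 → Ω → E → Option E) : Prop where
  /-- Joint measurability of `φ` into `E ∪ {∂}`. -/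
  measurable : ∀ A : Set E, MeasurableSet A →
    MeasurableSet {p : ℝ≥0 × Ω × E | ∃ y ∈ A, φ p.1 p.2.1 p.2.2 = some y}
  isOpen_domain : ∀ ω : Ω, IsOpen {p : ℝ≥0 × E | φ p.1 ω p.2 ≠ none}
  domain_mono : ∀ (ω : Ω) (x : E) (s t : ℝ≥0), s ≤ t → φ t ω x ≠ none → φ s ω x ≠ none
  /-- `x ↦ φ_t(ω, x)` is continuous at `x₀` whenever `φ_t(ω, x₀) ∈ E`. -/
  continuousAt : ∀ (t : ℝ≥0) (ω : Ω) (x₀ y₀ : E), φ t ω x₀ = some y₀ →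
    ∀ U ∈ 𝓝 y₀, ∀ᶠ x in 𝓝 x₀, ∃ y ∈ U, φ t ω x = some y
  zero : ∀ (ω : Ω) (x : E), φ 0 ω x = some x
  /-- The perfect cocycle property `φ_{t+s}(ω, x) = φ_t(θ_s ω, φ_s(ω, x))`. -/
  cocycle : ∀ (s t : ℝ≥0) (ω : Ω) (x : E),
    φ (t + s) ω x = (φ s ω x).bind (fun y => φ t (θ (s : ℝ) ω) y)

/-- `u` is the solution of `X_t = x + ∫_0^t b(X_s) ds + σ (w_t - w_0)` up to its explosion time
(`∂ = none` from that time on): as long as `u` lives it is continuous and satisfies the integral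
equation, and if it dies in finite time, then it is unbounded before. -/
structure IsSolutionUpToExplosion {d : ℕ} (b : State d → State d) (σ : ℝ) (w : ℝ → State d)
    (x : State d) (u : ℝ≥0 → Option (State d)) : Prop where
  continuousOn : ∀ t : ℝ≥0, u t ≠ none →
    ContinuousOn (fun s : ℝ≥0 => (u s).getD 0) (Set.Icc 0 t)
  integral_eq : ∀ (t : ℝ≥0) (y : State d), u t = some y →
    y = x + (∫ s in (0 : ℝ)..t, b ((u s.toNNReal).getD 0)) + σ • (w t - w 0)
  explosion : (∃ t, u t = none) → ¬ Bornology.IsBounded {y : State d | ∃ t, u t = some y}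

/-- `φ` is the (local) random dynamical system associated to the stochastic differential equation
`dX_t = b(X_t) dt + σ dW_t` in the canonical set-up: it is a (local) random dynamical system over
the Wiener shift, and, almost surely, `t ↦ φ_t(ω, x)` solves the equation with initial value `x`
up to explosion, for all `x`. -/
structure IsRDSOfSDE {d : ℕ} (P : Measure (PathSpace d)) (b : State d → State d) (σ : ℝ)
    (φ : ℝ≥0 → PathSpace d → State d → Option (State d)) : Prop where
  isLocalRDS : IsLocalRDS wienerShift φ
  solves : ∀ᵐ ω ∂P, ∀ x : State d,
    IsSolutionUpToExplosion b σ (fun t => ω t) x (fun t => φ t ω x)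

/-- Swift transitivity: for every ball `B(x, r)` and every point `y` there is a time `t > 0` with
`P(φ_t(·, B(x, r)) ⊆ B(y, 2r)) > 0`. -/
def SwiftTransitive {Ω E : Type*} [MeasurableSpace Ω] [MetricSpace E] (P : Measure Ω)
    (φ : ℝ≥0 → Ω → E → Option E) : Prop :=
  ∀ (x : E) (r : ℝ), 0 < r → ∀ y : E, ∃ t : ℝ≥0, 0 < t ∧
    0 < P {ω | φ t ω '' Metric.ball x r ⊆ some '' Metric.ball y (2 * r)}

/-- Contraction on large sets: for every `R > 0` there are a ball `B(y, R)` and a time `t > 0` with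
`P(diam φ_t(·, B(y, R)) ≤ R / 4) > 0`; the event includes that `φ_t(ω, B(y, R))` is a subset `A`
of `E`. -/
def ContractingOnLargeSets {Ω E : Type*} [MeasurableSpace Ω] [MetricSpace E] (P : Measure Ω)
    (φ : ℝ≥0 → Ω → E → Option E) : Prop :=
  ∀ R : ℝ, 0 < R → ∃ (y : E) (t : ℝ≥0), 0 < t ∧
    0 < P {ω | ∃ A : Set E, φ t ω '' Metric.ball y R = some '' A ∧
      Metric.ediam A ≤ ENNReal.ofReal (R / 4)}

/-- `b` is monotone on large sets: for each `r > 0` it is strictly monotone on some ball of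
radius `r`. -/
def MonotoneOnLargeSets {d : ℕ} (b : State d → State d) : Prop :=
  ∀ r : ℝ, 0 < r → ∃ z : State d, ∀ x ∈ Metric.ball z r, ∀ y ∈ Metric.ball z r, x ≠ y →
    inner ℝ (b x - b y) (x - y) < 0

/-! Everything is reduced to noise that follows a path of constant speed, an event of positive
probability (`measure_close_linear_pos`). On that event the claims are deterministic and hold for
all starting points in the ball at once.

Probability: some path is in the support of the Wiener measure. The scaled difference of two
independent copies near that path is again Wiener and is small, so small balls around `0` have
positive mass. A Brownian path is the sum of its bridge and a linear interpolation, and the bridge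
is independent of the endpoint. A small bridge together with a Gaussian endpoint near `T • a` gives
a path near `s ↦ s • a`.

Dynamics: for parts 1 and 2 the noise moves by `z` within a time so short that the drift contributes
almost nothing (`exists_mem_ball_of_noise_near`). For part 3 the noise follows `-s • b z`, so that
solutions nearly follow `b - b z`; this field points towards `z` by monotonicity and pulls the ball
into a small neighbourhood of `z` (`exists_near_of_noise_near`). Both arguments also bound the
solution, which excludes explosion. -/

/-! ### Full support of Gaussian measures -/

theorem isOpenPosMeasure_gaussianReal (m : ℝ) {v : ℝ≥0} (hv : v ≠ 0) :
    (gaussianReal m v).IsOpenPosMeasure :=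
  (gaussianReal_absolutelyContinuous' m hv).isOpenPosMeasure

theorem isOpenPosMeasure_stdGaussian (E : Type*) [NormedAddCommGroup E] [InnerProductSpace ℝ E]
    [FiniteDimensional ℝ E] [MeasurableSpace E] [BorelSpace E] :
    (stdGaussian E).IsOpenPosMeasure := by
  have := isOpenPosMeasure_gaussianReal 0 one_ne_zero
  rw [stdGaussian]
  refine Continuous.isOpenPosMeasure_map (by fun_prop) fun y => ?_
  exact ⟨fun i => inner ℝ (stdOrthonormalBasis ℝ E i) y, (stdOrthonormalBasis ℝ E).sum_repr' y⟩

/-! ### Linear paths in the support of the Wiener measure -/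

namespace IsWienerMeasure

variable {d : ℕ} {P : Measure (PathSpace d)}

theorem measurable_eval (t : ℝ) : Measurable fun ω : PathSpace d => ω t :=
  (continuous_eval_const t).measurable

theorem hasLaw_eval (hP : IsWienerMeasure P) (t : ℝ≥0) :
    HasLaw (fun ω : PathSpace d => ω t)
      ((stdGaussian (State d)).map (fun x => Real.sqrt t • x)) P := by
  have h := hP.law_increments 0 t t.2
  rw [sub_zero] at h
  refine h.congr ?_
  filter_upwards [hP.start_zero] with ω hω
  simp [hω]

theorem hasGaussianLaw_eval (hP : IsWienerMeasure P) (t : ℝ≥0) :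
    HasGaussianLaw (fun ω : PathSpace d => ω t) P := by
  have : IsGaussian ((stdGaussian (State d)).map (fun x => Real.sqrt t • x)) :=
    isGaussian_map (Real.sqrt t • ContinuousLinearMap.id ℝ (State d))
  exact (hP.hasLaw_eval t).hasGaussianLaw

theorem hasIndepIncrements (hP : IsWienerMeasure P) :
    HasIndepIncrements (fun (t : ℝ≥0) (ω : PathSpace d) => ω t) P :=
  fun n t ht => hP.indep_increments n (fun i => (t i : ℝ)) fun _ _ h => ht h

theorem isGaussianProcess (hP : IsWienerMeasure P) :
    IsGaussianProcess (fun (t : ℝ≥0) (ω : PathSpace d) => ω t) P :=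
  hP.hasIndepIncrements.isGaussianProcess hP.hasGaussianLaw_eval
    (by simpa using hP.start_zero)

theorem integral_eval (hP : IsWienerMeasure P) (t : ℝ≥0) : ∫ ω : PathSpace d, ω t ∂P = 0 := by
  rw [(hP.hasLaw_eval t).integral_eq, integral_map (by fun_prop) (by fun_prop), integral_smul]
  simp

/-- Splitting `ω t = ω s + (ω t - ω s)`, the increment is independent of `ω s` and contributes
nothing. -/
theorem covariance_eval (hP : IsWienerMeasure P) {s t : ℝ≥0} (hst : s ≤ t)
    (L₁ L₂ : StrongDual ℝ (State d)) :
    cov[fun ω : PathSpace d => L₁ (ω s), fun ω : PathSpace d => L₂ (ω t); P] =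
      s * cov[L₁, L₂; stdGaussian (State d)] := by
  have := hP.isProbabilityMeasure
  have hL : ∀ (L : StrongDual ℝ (State d)) (r : ℝ≥0),
      MemLp (fun ω : PathSpace d => L (ω r)) 2 P :=
    fun L r => ((hP.hasGaussianLaw_eval r).map_fun L).memLp_two
  have hind := (hP.hasIndepIncrements.indepFun_eval_sub zero_le hst
    (by simpa using hP.start_zero)).comp L₁.continuous.measurable L₂.continuous.measurable
  have hsub : (fun ω : PathSpace d => L₂ (ω t)) =
      (fun ω : PathSpace d => L₂ (ω s)) + (fun ω : PathSpace d => L₂ (ω t - ω s)) := by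
    ext ω; simp
  have hsub' : MemLp (fun ω : PathSpace d => L₂ (ω t - ω s)) 2 P := by
    simpa [Pi.sub_def] using (hL L₂ t).sub (hL L₂ s)
  have h0 : cov[fun ω : PathSpace d => L₁ (ω s), fun ω : PathSpace d => L₂ (ω t - ω s); P] = 0 :=
    hind.covariance_eq_zero (hL L₁ s) hsub'
  rw [hsub, covariance_add_right (hL L₁ s) (hL L₂ s) hsub', h0, add_zero,
    (hP.hasLaw_eval s).covariance_fun_comp (by fun_prop) (by fun_prop),
    covariance_map_fun (by fun_prop) (by fun_prop) (by fun_prop)]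
  simp only [map_smul, smul_eq_mul, covariance_const_mul_left, covariance_const_mul_right]
  rw [← mul_assoc, Real.mul_self_sqrt s.coe_nonneg]

/-- By rotation invariance of centred Gaussian measures, the probability that finitely many values
are small is at least the squared probability that they are close to a given path. -/
theorem sq_measure_close_le (hP : IsWienerMeasure P) (I : Finset ℝ≥0) (f : ℝ≥0 → State d)
    (ε : ℝ) :
    P {ω | ∀ s ∈ I, ‖ω s - f s‖ ≤ ε / 2} ^ 2 ≤ P {ω | ∀ s ∈ I, ‖ω s‖ ≤ ε} := by
  have := hP.isProbabilityMeasure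
  have hX : Measurable fun (ω : PathSpace d) (i : I) => ω (i : ℝ≥0) :=
    measurable_pi_lambda _ fun i => measurable_eval _
  have hG : IsGaussian (P.map fun (ω : PathSpace d) (i : I) => ω (i : ℝ≥0)) :=
    (hP.isGaussianProcess.hasGaussianLaw I).isGaussian_map
  set μ := P.map fun (ω : PathSpace d) (i : I) => ω (i : ℝ≥0) with hμ
  have hm : μ[id] = 0 := by
    ext1 i
    rw [← ContinuousLinearMap.proj_apply (R := ℝ) (φ := fun _ : I => State d) i (∫ x, id x ∂μ),
      ← ContinuousLinearMap.integral_comp_comm _ IsGaussian.integrable_id, hμ,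
      integral_map hX.aemeasurable (by fun_prop)]
    simpa using hP.integral_eval i
  -- The second coordinate of the rotated pair is `(y - x) / √2`, in which `f` cancels. Rotation
  -- therefore sends `A ×ˢ A` into `univ ×ˢ B` while preserving `μ.prod μ`.
  have hrot := IsGaussian.map_rotation_eq_self hm (Real.pi / 4)
  let A : Set (I → State d) := {x | ∀ i, ‖x i - f i‖ ≤ ε / 2}
  let B : Set (I → State d) := {x | ∀ i, ‖x i‖ ≤ ε}
  have hA : IsClosed A := by
    simp only [A, ofPred_forall]
    exact isClosed_iInter fun i => isClosed_le (by fun_prop) (by fun_prop)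
  have hB : IsClosed B := by
    simp only [B, ofPred_forall]
    exact isClosed_iInter fun i => isClosed_le (by fun_prop) (by fun_prop)
  have hPA : μ A = P {ω | ∀ s ∈ I, ‖ω s - f s‖ ≤ ε / 2} := by
    rw [hμ, Measure.map_apply hX hA.measurableSet]
    congr 1; ext ω; simp [A]
  have hPB : μ B = P {ω | ∀ s ∈ I, ‖ω s‖ ≤ ε} := by
    rw [hμ, Measure.map_apply hX hB.measurableSet]
    congr 1; ext ω; simp [B]
  rw [← hPA, ← hPB, sq, ← Measure.prod_prod]
  have huniv : μ B = (μ.prod μ) (univ ×ˢ B) := by simp [Measure.prod_prod]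
  rw [huniv]
  conv_rhs => rw [← hrot]
  rw [Measure.map_apply (by fun_prop) (MeasurableSet.univ.prod hB.measurableSet)]
  refine measure_mono ?_
  rintro ⟨x, y⟩ ⟨hx, hy⟩
  refine ⟨mem_univ _, fun i => ?_⟩
  have h1 : ‖y i - x i‖ ≤ ε := by
    calc ‖y i - x i‖ = ‖(y i - f i) - (x i - f i)‖ := by congr 1; abel
      _ ≤ ‖y i - f i‖ + ‖x i - f i‖ := norm_sub_le _ _
      _ ≤ ε / 2 + ε / 2 := add_le_add (hy i) (hx i)
      _ = ε := by ring
  have h2 : Real.sqrt 2 / 2 ≤ 1 := by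
    have : Real.sqrt 2 ≤ 2 := Real.sqrt_le_iff.2 (by norm_num)
    linarith
  have h3 : (ContinuousLinearMap.rotation (Real.pi / 4) (x, y)).2 i =
      (Real.sqrt 2 / 2) • (y i - x i) := by
    simp only [ContinuousLinearMap.rotation_apply, Real.cos_pi_div_four, Real.sin_pi_div_four,
      Pi.add_apply, Pi.smul_apply]
    module
  rw [h3, norm_smul, Real.norm_of_nonneg (by positivity)]
  calc Real.sqrt 2 / 2 * ‖y i - x i‖ ≤ 1 * ‖y i - x i‖ := by gcongr
    _ ≤ ε := by rwa [one_mul]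

/-- The path space carries a path all of whose neighbourhoods are charged. -/
theorem exists_measure_close_pos (hP : IsWienerMeasure P) (T : ℝ≥0) {ε : ℝ} (hε : 0 < ε) :
    ∃ f : PathSpace d, 0 < P {ω | ∀ s : ℝ≥0, s ≤ T → ‖ω s - f s‖ ≤ ε} := by
  have := hP.isProbabilityMeasure
  -- The path space is second countable, so a nonzero measure on it has nonempty support.
  obtain ⟨f, -, hf⟩ := exists_mem_forall_mem_nhdsWithin_pos_measure (μ := P) (s := univ) (by simp)
  refine ⟨f, hf _ ?_⟩
  rw [nhdsWithin_univ]
  have h := ContinuousMap.tendsto_iff_forall_isCompact_tendstoUniformlyOn.1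
    (tendsto_id (x := 𝓝 f)) (Icc 0 (T : ℝ)) isCompact_Icc
  filter_upwards [Metric.tendstoUniformlyOn_iff.1 h ε hε] with ω hω s hs
  have := hω s ⟨s.2, by exact_mod_cast hs⟩
  rw [dist_comm, dist_eq_norm] at this
  exact this.le

/-- Small ball probabilities of the Wiener measure are positive. -/
theorem measure_norm_le_pos (hP : IsWienerMeasure P) (T : ℝ≥0) {ε : ℝ} (hε : 0 < ε) :
    0 < P {ω | ∀ s : ℝ≥0, s ≤ T → ‖ω s‖ ≤ ε} := by
  have := hP.isProbabilityMeasure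
  obtain ⟨f, hf⟩ := hP.exists_measure_close_pos T (half_pos hε)
  -- The lower bound for finitely many times does not depend on their number. It survives the limit
  -- along times dense in `[0, T]`, and continuity of paths gives the remaining times.
  let u : ℕ → ℝ≥0 := fun k => min (TopologicalSpace.denseSeq ℝ≥0 k) T
  let C : ℕ → Set (PathSpace d) := fun n => {ω | ∀ s ∈ (Finset.range n).image u, ‖ω s‖ ≤ ε}
  have hC : ∀ n, MeasurableSet (C n) := by
    intro n
    refine IsClosed.measurableSet ?_
    simp only [C, ofPred_forall]
    exact isClosed_iInter fun s => isClosed_iInter fun _ =>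
      isClosed_le (continuous_eval_const _).norm continuous_const
  have hCanti : Antitone C := fun m n hmn ω hω s hs =>
    hω s (Finset.image_subset_image (Finset.range_mono hmn) hs)
  have hlim := tendsto_measure_iInter_atTop (μ := P) (fun n => (hC n).nullMeasurableSet) hCanti
    ⟨0, measure_ne_top P _⟩
  have hle : P {ω | ∀ s : ℝ≥0, s ≤ T → ‖ω s - f s‖ ≤ ε / 2} ^ 2 ≤ P (⋂ n, C n) := by
    refine ge_of_tendsto' hlim fun n => le_trans ?_
      (hP.sq_measure_close_le ((Finset.range n).image u) (fun s => f s) ε)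
    refine pow_le_pow_left' (measure_mono fun ω hω s hs => ?_) 2
    obtain ⟨k, -, rfl⟩ := Finset.mem_image.1 hs
    exact hω _ (min_le_right _ _)
  refine (lt_of_lt_of_le (ENNReal.pow_pos hf 2) hle).trans_le (measure_mono fun ω hω s hs => ?_)
  have hcl : IsClosed {s : ℝ≥0 | ‖ω ((min s T : ℝ≥0) : ℝ)‖ ≤ ε} :=
    isClosed_le (by fun_prop) continuous_const
  have hsub : range (TopologicalSpace.denseSeq ℝ≥0) ⊆
      {s : ℝ≥0 | ‖ω ((min s T : ℝ≥0) : ℝ)‖ ≤ ε} := by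
    rintro _ ⟨k, rfl⟩
    exact mem_iInter.1 hω (k + 1) (u k)
      (Finset.mem_image_of_mem u (Finset.mem_range.2 k.lt_succ_self))
  have := hcl.closure_subset_iff.2 hsub (TopologicalSpace.denseRange_denseSeq ℝ≥0 s)
  rwa [mem_ofPred_eq, min_eq_left hs] at this

/-- The bridge `W_s - (s / T) W_T`, `s ≤ T`, is independent of the endpoint `W_T`. -/
theorem indepFun_bridge (hP : IsWienerMeasure P) {T : ℝ≥0} (hT : 0 < T) :
    IndepFun (fun (ω : PathSpace d) (s : ℝ≥0) =>
        ω (min s T : ℝ≥0) - ((min s T : ℝ≥0) / T : ℝ) • ω T)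
      (fun (ω : PathSpace d) (_ : Unit) => ω T) P := by
  have := hP.isProbabilityMeasure
  have hL : ∀ (L : StrongDual ℝ (State d)) (r : ℝ≥0),
      MemLp (fun ω : PathSpace d => L (ω r)) 2 P :=
    fun L r => ((hP.hasGaussianLaw_eval r).map_fun L).memLp_two
  have hX (s : ℝ≥0) : Measurable fun ω : PathSpace d =>
      ω (min s T : ℝ≥0) - ((min s T : ℝ≥0) / T : ℝ) • ω T := by
    have hT := measurable_eval (d := d) T
    have hs := measurable_eval (d := d) (min s T : ℝ≥0)
    fun_prop
  refine IsGaussianProcess.indepFun_of_covariance_strongDual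
    (X := fun (s : ℝ≥0) (ω : PathSpace d) =>
      ω (min s T : ℝ≥0) - ((min s T : ℝ≥0) / T : ℝ) • ω T)
    (Y := fun (_ : Unit) (ω : PathSpace d) => ω T)
    (hP.isGaussianProcess.of_isGaussianProcess ?_)
    (fun s => (hX s).aemeasurable)
    (fun _ => (measurable_eval _).aemeasurable) ?_
  · rintro (s | _)
    · classical
      refine ⟨{min s T, T}, ContinuousLinearMap.proj ⟨min s T, by simp⟩ -
        ((min s T : ℝ≥0) / T : ℝ) • ContinuousLinearMap.proj ⟨T, by simp⟩, fun ω => rfl⟩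
    · exact ⟨{T}, ContinuousLinearMap.proj ⟨T, by simp⟩, fun ω => rfl⟩
  · rintro s - L₁ L₂
    generalize hr : min s T = r
    have hrT : r ≤ T := hr ▸ min_le_right _ _
    have hcomp : L₁ ∘ (fun ω : PathSpace d => ω r - (r / T : ℝ) • ω T) =
        (fun ω : PathSpace d => L₁ (ω r)) - (r / T : ℝ) • fun ω : PathSpace d => L₁ (ω T) := by
      ext ω; simp
    have hcomp' : L₂ ∘ (fun ω : PathSpace d => ω T) = fun ω : PathSpace d => L₂ (ω T) := rfl
    have hT' : (T : ℝ) ≠ 0 := by exact_mod_cast hT.ne'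
    -- For jointly Gaussian processes zero covariance suffices: both terms equal `r` times the
    -- covariance of `L₁` and `L₂` under the standard Gaussian.
    rw [hcomp, hcomp', covariance_sub_left (hL _ _) ((hL _ _).const_smul _) (hL _ _),
      covariance_smul_left, hP.covariance_eval hrT, hP.covariance_eval le_rfl, ← mul_assoc,
      div_mul_cancel₀ _ hT', sub_self]

theorem measure_endpoint_pos (hP : IsWienerMeasure P) {T : ℝ≥0} (hT : 0 < T) (a : State d)
    {ε : ℝ} (hε : 0 < ε) : 0 < P {ω | ‖ω T - a‖ ≤ ε} := by
  have := isOpenPosMeasure_stdGaussian (State d)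
  have hT' : Real.sqrt T ≠ 0 := (Real.sqrt_pos.2 (by exact_mod_cast hT)).ne'
  have : ((stdGaussian (State d)).map (fun x => Real.sqrt T • x)).IsOpenPosMeasure :=
    Continuous.isOpenPosMeasure_map (by fun_prop) (MulAction.surjective₀ hT')
  rw [(hP.hasLaw_eval T).measure_eq (p := fun x => ‖x - a‖ ≤ ε)
    (isClosed_le (by fun_prop) (by fun_prop)).measurableSet]
  refine (Metric.measure_ball_pos _ a hε).trans_le (measure_mono fun x hx => ?_)
  exact (mem_ball_iff_norm.1 hx).le

/-- Every path of constant speed is in the support of the Wiener measure. -/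
theorem measure_close_linear_pos (hP : IsWienerMeasure P) {T : ℝ≥0} (hT : 0 < T) (a : State d)
    {ε : ℝ} (hε : 0 < ε) :
    0 < P {ω | ∀ s : ℝ≥0, s ≤ T → ‖ω s - ω 0 - (s : ℝ) • a‖ ≤ ε} := by
  have hT0 : (0 : ℝ) < T := by exact_mod_cast hT
  -- Restricting to countably many times makes `A` measurable in the product `σ`-field, where
  -- independence is stated.
  let D := range (TopologicalSpace.denseSeq ℝ≥0)
  let A : Set (ℝ≥0 → State d) := {y | ∀ s ∈ D, ‖y s‖ ≤ ε / 2}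
  let B : Set (Unit → State d) := {y | ‖y () - (T : ℝ) • a‖ ≤ ε / 2}
  have hA : MeasurableSet A := by
    simp only [A, ofPred_forall]
    exact MeasurableSet.biInter (countable_range _) fun s _ =>
      measurableSet_le (by fun_prop) measurable_const
  have hB : MeasurableSet B := measurableSet_le (by fun_prop) measurable_const
  have hind := (hP.indepFun_bridge hT).measure_inter_preimage_eq_mul A B hA hB
  have hApos : 0 < P ((fun (ω : PathSpace d) (s : ℝ≥0) =>
      ω (min s T : ℝ≥0) - ((min s T : ℝ≥0) / T : ℝ) • ω T) ⁻¹' A) := by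
    refine (hP.measure_norm_le_pos T (show 0 < ε / 4 by positivity)).trans_le
      (measure_mono fun ω hω s _ => ?_)
    have hr : min s T ≤ T := min_le_right _ _
    have h1 := hω _ hr
    have h2 := hω T le_rfl
    have h3 : ((min s T : ℝ≥0) / T : ℝ) ≤ 1 := (div_le_one hT0).2 (by exact_mod_cast hr)
    calc ‖ω (min s T : ℝ≥0) - ((min s T : ℝ≥0) / T : ℝ) • ω T‖
        ≤ ‖ω (min s T : ℝ≥0)‖ + ‖((min s T : ℝ≥0) / T : ℝ) • ω T‖ := norm_sub_le _ _
      _ = ‖ω (min s T : ℝ≥0)‖ + ((min s T : ℝ≥0) / T : ℝ) * ‖ω T‖ := by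
        rw [norm_smul, Real.norm_of_nonneg (by positivity)]
      _ ≤ ε / 4 + 1 * (ε / 4) := by gcongr
      _ = ε / 2 := by ring
  have hBpos : 0 < P ((fun (ω : PathSpace d) (_ : Unit) => ω T) ⁻¹' B) :=
    hP.measure_endpoint_pos hT ((T : ℝ) • a) (half_pos hε)
  have hpos := ENNReal.mul_pos hApos.ne' hBpos.ne'
  rw [← hind] at hpos
  refine hpos.trans_le (measure_mono_ae ?_)
  filter_upwards [hP.start_zero] with ω hω0 hω s hs
  obtain ⟨hωA, hωB⟩ := hω
  have hcl : IsClosed {s : ℝ≥0 |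
      ‖ω (min s T : ℝ≥0) - ((min s T : ℝ≥0) / T : ℝ) • ω T‖ ≤ ε / 2} :=
    isClosed_le (by fun_prop) continuous_const
  have h1 := hcl.closure_subset_iff.2 hωA (TopologicalSpace.denseRange_denseSeq ℝ≥0 s)
  rw [mem_ofPred_eq, min_eq_left hs] at h1
  have h2 : ‖ω T - (T : ℝ) • a‖ ≤ ε / 2 := hωB
  have h3 : (s / T : ℝ) ≤ 1 := (div_le_one hT0).2 (by exact_mod_cast hs)
  have h4 : ω s - ω 0 - (s : ℝ) • a =
      (ω s - (s / T : ℝ) • ω T) + (s / T : ℝ) • (ω T - (T : ℝ) • a) := by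
    rw [hω0, sub_zero, smul_sub, smul_smul, div_mul_cancel₀ _ hT0.ne']
    abel
  change ‖ω s - ω 0 - (s : ℝ) • a‖ ≤ ε
  rw [h4]
  calc _ ≤ ‖ω s - (s / T : ℝ) • ω T‖ + ‖(s / T : ℝ) • (ω T - (T : ℝ) • a)‖ := norm_add_le _ _
    _ = ‖ω s - (s / T : ℝ) • ω T‖ + (s / T : ℝ) * ‖ω T - (T : ℝ) • a‖ := by
      rw [norm_smul, Real.norm_of_nonneg (by positivity)]
    _ ≤ ε / 2 + 1 * (ε / 2) := by gcongr
    _ = ε := by ring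

end IsWienerMeasure

/-! ### Deterministic estimates for a given noise path -/

namespace IsSolutionUpToExplosion

variable {d : ℕ} {b : State d → State d} {σ : ℝ} {w : ℝ → State d} {x : State d}
  {u : ℝ≥0 → Option (State d)}

/-- Up to a time at which it is alive, a solution is the sum of a differentiable path and the
noise. -/
theorem exists_decomposition (h : IsSolutionUpToExplosion b σ w x u) (hb : Continuous b) {t : ℝ≥0}
    (ht : ∀ s ≤ t, u s ≠ none) :
    ∃ v Y : ℝ → State d, Y 0 = x ∧ (∀ s, HasDerivAt Y (b (v s)) s) ∧
      ∀ s : ℝ≥0, s ≤ t → u s = some (v s) ∧ v s = Y s + σ • (w s - w 0) := by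
  have hcont : ContinuousOn (fun s : ℝ => (u s.toNNReal).getD 0) (Icc 0 (t : ℝ)) :=
    (h.continuousOn t (ht t le_rfl)).comp continuous_real_toNNReal.continuousOn fun s hs =>
      ⟨zero_le, Real.toNNReal_le_iff_le_coe.2 hs.2⟩
  -- Constant extension outside `[0, t]` makes the integrand continuous on `ℝ`, so its primitive is
  -- differentiable everywhere.
  let v : ℝ → State d := IccExtend t.coe_nonneg
    ((Icc 0 (t : ℝ)).domRestrict fun s : ℝ => (u s.toNNReal).getD 0)
  have hv : Continuous v := (continuousOn_iff_continuous_domRestrict.1 hcont).Icc_extend'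
  have hvu : ∀ s ∈ Icc 0 (t : ℝ), v s = (u s.toNNReal).getD 0 := fun s hs =>
    IccExtend_of_mem _ _ hs
  refine ⟨v, fun s => x + ∫ r in (0 : ℝ)..s, b (v r), by simp, fun s => ?_, fun s hs => ?_⟩
  · exact ((hb.comp hv).integral_hasStrictDerivAt 0 s).hasDerivAt.const_add x
  · obtain ⟨y, hy⟩ := Option.ne_none_iff_exists'.1 (ht s hs)
    have hvs : v s = y := by
      rw [hvu s ⟨s.coe_nonneg, by exact_mod_cast hs⟩]
      simp [hy]
    refine ⟨by rw [hy, hvs], ?_⟩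
    rw [hvs, h.integral_eq s y hy]
    congr 2
    refine intervalIntegral.integral_congr fun r hr => ?_
    rw [uIcc_of_le s.coe_nonneg] at hr
    rw [hvu r ⟨hr.1, hr.2.trans (by exact_mod_cast hs)⟩]

/-- A solution which stays bounded as long as it lives does not die. -/
theorem ne_none_of_norm_le (h : IsSolutionUpToExplosion b σ w x u)
    (hmono : ∀ s t : ℝ≥0, s ≤ t → u t ≠ none → u s ≠ none) {t₀ : ℝ≥0} {C : ℝ}
    (hC : ∀ t ≤ t₀, ∀ y, u t = some y → ‖y‖ ≤ C) : u t₀ ≠ none := by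
  intro h0
  refine h.explosion ⟨t₀, h0⟩ (isBounded_iff_forall_norm_le.2 ⟨C, ?_⟩)
  rintro y ⟨t, hy⟩
  refine hC t ?_ y hy
  by_contra! hlt
  exact hmono t₀ t hlt.le (by simp [hy]) h0

/-- If the noise is close to a fast linear motion, then so is the solution. -/
theorem exists_mem_ball_of_noise_near (h : IsSolutionUpToExplosion b σ w x u) (hb : Continuous b)
    (hmono : ∀ s t : ℝ≥0, s ≤ t → u t ≠ none → u s ≠ none) {t₀ : ℝ≥0} (ht₀ : 0 < t₀)
    {M δ : ℝ} (hδ : 0 < δ) {z : State d} (hM : ∀ y, ‖y - x‖ ≤ ‖z‖ + δ → ‖b y‖ ≤ M)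
    (hMt : (M + 1) * t₀ ≤ δ / 4)
    (hw : ∀ s : ℝ≥0, s ≤ t₀ → ‖σ • (w s - w 0) - ((s : ℝ) / t₀) • z‖ ≤ δ / 4) :
    ∃ y ∈ Metric.ball (x + z) δ, u t₀ = some y := by
  have ht₀' : (0 : ℝ) < t₀ := by exact_mod_cast ht₀
  have hM0 : 0 ≤ M := (norm_nonneg _).trans (hM x (by rw [sub_self, norm_zero]; positivity))
  have key : ∀ t ≤ t₀, ∀ y, u t = some y → ‖y - x - ((t : ℝ) / t₀) • z‖ ≤ δ / 2 := by
    intro t ht y hy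
    obtain ⟨v, Y, hY0, hY, hv⟩ := h.exists_decomposition hb (t := t)
      fun s hs => hmono s t hs (by simp [hy])
    have hbound : ∀ s ∈ Icc 0 (t : ℝ), ‖Y s - x‖ ≤ (M + 1) * s := by
      -- The derivative need only be compared at times where the bound is attained. There `v s` is
      -- still in the region where `‖b‖ ≤ M`, and the slope `M + 1` makes the comparison strict.
      refine image_norm_le_of_norm_deriv_right_lt_deriv_boundary (B' := fun _ => M + 1)
        (f' := fun s => b (v s)) ?_ ?_ (by simp [hY0]) ?_ ?_
      · exact fun s _ => ((hY s).sub_const x).continuousAt.continuousWithinAt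
      · exact fun s _ => ((hY s).sub_const x).hasDerivWithinAt
      · exact fun s => by simpa using (hasDerivAt_id s).const_mul (M + 1)
      · intro s hs hs'
        lift s to ℝ≥0 using hs.1
        have hst : s ≤ t := by exact_mod_cast hs.2.le
        have hst₀ : (s : ℝ) ≤ t₀ := by exact_mod_cast hst.trans ht
        refine (hM _ ?_).trans_lt (lt_add_one M)
        have h1 : ‖Y s - x‖ ≤ δ / 4 := by
          rw [hs']
          exact le_trans (by gcongr) hMt
        have h2 := hw s (hst.trans ht)
        have h3 : ‖((s : ℝ) / t₀) • z‖ ≤ ‖z‖ := by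
          rw [norm_smul, Real.norm_of_nonneg (by positivity)]
          exact mul_le_of_le_one_left (norm_nonneg _) ((div_le_one ht₀').2 hst₀)
        have h4 : v s - x = (Y s - x) + (σ • (w s - w 0) - ((s : ℝ) / t₀) • z) +
            ((s : ℝ) / t₀) • z := by
          rw [(hv s hst).2]; abel
        rw [h4]
        refine (norm_add₃_le).trans ?_
        linarith
    have h1 := hbound t ⟨t.coe_nonneg, le_rfl⟩
    have h1' : (M + 1) * (t : ℝ) ≤ δ / 4 := le_trans (by gcongr) hMt
    have h2 := hw t ht
    have hyv : y = v t := Option.some_injective _ (hy.symm.trans (hv t le_rfl).1)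
    have h4 : y - x - ((t : ℝ) / t₀) • z = (Y t - x) + (σ • (w t - w 0) - ((t : ℝ) / t₀) • z) := by
      rw [hyv, (hv t le_rfl).2]; abel
    rw [h4]
    refine (norm_add_le _ _).trans ?_
    linarith
  have hne : u t₀ ≠ none := by
    refine h.ne_none_of_norm_le hmono (C := δ / 2 + ‖x‖ + ‖z‖) fun t ht y hy => ?_
    have h1 := key t ht y hy
    have h3 : ‖((t : ℝ) / t₀) • z‖ ≤ ‖z‖ := by
      rw [norm_smul, Real.norm_of_nonneg (by positivity)]
      exact mul_le_of_le_one_left (norm_nonneg _) ((div_le_one ht₀').2 (by exact_mod_cast ht))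
    have h4 : y = (y - x - ((t : ℝ) / t₀) • z) + x + ((t : ℝ) / t₀) • z := by abel
    rw [h4]
    refine (norm_add₃_le).trans ?_
    linarith
  obtain ⟨y, hy⟩ := Option.ne_none_iff_exists'.1 hne
  refine ⟨y, ?_, hy⟩
  have h1 := key t₀ le_rfl y hy
  rw [div_self ht₀'.ne', one_smul] at h1
  rw [mem_ball_iff_norm, ← sub_sub]
  linarith

/-- If the drift points towards `z` and the noise nearly cancels `b z`, then the solution is close
to `z` after some time. -/
theorem exists_near_of_noise_near (h : IsSolutionUpToExplosion b σ w x u) (hb : Continuous b)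
    (hmono : ∀ s t : ℝ≥0, s ≤ t → u t ≠ none → u s ≠ none) {t₀ : ℝ≥0} {R η κ c : ℝ}
    (hη : 0 < η) (hηR : η ≤ R) (hc : 0 < c) (hct : R ^ 2 ≤ c * t₀) {z : State d}
    (hx : ‖x - z‖ ≤ R)
    (hF : ∀ p e : State d, η ≤ ‖p - z‖ → ‖p - z‖ ≤ 2 * R → ‖e‖ ≤ κ →
      inner ℝ (p - z) (b (p + e) - b z) ≤ -c)
    (hw : ∀ s : ℝ≥0, s ≤ t₀ → ‖σ • (w s - w 0) + (s : ℝ) • b z‖ ≤ κ) :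
    ∃ y, ‖y - z‖ ≤ η + κ ∧ u t₀ = some y := by
  have hR : 0 < R := hη.trans_le hηR
  have ht₀' : (0 : ℝ) < t₀ := pos_of_mul_pos_right ((by positivity : 0 < R ^ 2).trans_le hct) hc.le
  have hrate : R ^ 2 / t₀ ≤ c := (div_le_iff₀ ht₀').2 hct
  have key : ∀ t ≤ t₀, ∀ y, u t = some y → ∃ p e : State d, y = p + e ∧ ‖e‖ ≤ κ ∧
      ‖p - z‖ ^ 2 ≤ η ^ 2 + R ^ 2 - R ^ 2 / t₀ * t := by
    intro t ht y hy
    obtain ⟨v, Y, hY0, hY, hv⟩ := h.exists_decomposition hb (t := t)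
      fun s hs => hmono s t hs (by simp [hy])
    have hZ : ∀ s, HasDerivAt (fun s => Y s - s • b z - z) (b (v s) - b z) s := fun s => by
      simpa using ((hY s).sub ((hasDerivAt_id s).smul_const (b z))).sub_const z
    have hvZ : ∀ s : ℝ≥0, s ≤ t →
        v s = (Y s - (s : ℝ) • b z) + (σ • (w s - w 0) + (s : ℝ) • b z) := fun s hs => by
      rw [(hv s hs).2]; abel
    have hbound : ∀ s ∈ Icc 0 (t : ℝ),
        ‖Y s - s • b z - z‖ ^ 2 ≤ η ^ 2 + R ^ 2 - R ^ 2 / t₀ * s := by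
      -- The barrier falls linearly from `η ^ 2 + R ^ 2` to `η ^ 2` at `t₀`. Where it is touched,
      -- the path is in the annulus of `hF`, so its squared distance to `z` decreases at rate at
      -- least `2 * c`, strictly faster than the barrier, whose rate is at most `c`.
      refine image_le_of_deriv_right_lt_deriv_boundary (B' := fun _ => -(R ^ 2 / t₀))
        (f' := fun s => 2 * inner ℝ (Y s - s • b z - z) (b (v s) - b z)) ?_ ?_ ?_ ?_ ?_
      · exact fun s _ => (hZ s).norm_sq.continuousAt.continuousWithinAt
      · exact fun s _ => (hZ s).norm_sq.hasDerivWithinAt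
      · simp only [hY0, zero_smul, sub_zero, mul_zero]
        nlinarith [norm_nonneg (x - z)]
      · exact fun s => by
          simpa using ((hasDerivAt_id s).const_mul (R ^ 2 / (t₀ : ℝ))).const_sub (η ^ 2 + R ^ 2)
      · intro s hs hs'
        lift s to ℝ≥0 using hs.1
        have hst : s ≤ t := by exact_mod_cast hs.2.le
        have hst₀ : (s : ℝ) ≤ t₀ := by exact_mod_cast hst.trans ht
        have h1 : R ^ 2 / t₀ * s ≤ R ^ 2 := by
          rw [div_mul_eq_mul_div]
          exact (div_le_iff₀ ht₀').2 (by gcongr)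
        have h2 : 0 ≤ R ^ 2 / t₀ * s := by positivity
        have h3 : η ≤ ‖Y s - (s : ℝ) • b z - z‖ :=
          (sq_le_sq₀ hη.le (norm_nonneg _)).1 (by rw [hs']; linarith)
        have h4 : ‖Y s - (s : ℝ) • b z - z‖ ≤ 2 * R :=
          (sq_le_sq₀ (norm_nonneg _) (by positivity)).1 (by rw [hs']; nlinarith)
        have h5 := hF _ _ h3 h4 (hw s (hst.trans ht))
        rw [← hvZ s hst] at h5
        linarith
    refine ⟨_, _, ?_, hw t ht, hbound t ⟨t.coe_nonneg, le_rfl⟩⟩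
    rw [← hvZ t le_rfl]
    exact Option.some_injective _ (hy.symm.trans (hv t le_rfl).1)
  have hne : u t₀ ≠ none := by
    refine h.ne_none_of_norm_le hmono (C := 2 * R + ‖z‖ + κ) fun t ht y hy => ?_
    obtain ⟨p, e, rfl, he, hp⟩ := key t ht y hy
    have h2 : 0 ≤ R ^ 2 / t₀ * t := by positivity
    have h4 : ‖p - z‖ ≤ 2 * R := (sq_le_sq₀ (norm_nonneg _) (by positivity)).1 (by nlinarith)
    have h5 : p + e = (p - z) + z + e := by abel
    rw [h5]
    refine (norm_add₃_le).trans ?_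
    linarith
  obtain ⟨y, hy⟩ := Option.ne_none_iff_exists'.1 hne
  obtain ⟨p, e, rfl, he, hp⟩ := key t₀ le_rfl y hy
  refine ⟨p + e, ?_, hy⟩
  rw [div_mul_cancel₀ _ ht₀'.ne', add_sub_cancel_right] at hp
  have h1 : ‖p - z‖ ≤ η := (sq_le_sq₀ (norm_nonneg _) hη.le).1 hp
  have h5 : p + e - z = (p - z) + e := by abel
  rw [h5]
  exact (norm_add_le _ _).trans (add_le_add h1 he)

end IsSolutionUpToExplosion

/-- Strict monotonicity is quantitative on annuli, and stable under small perturbations. -/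
theorem exists_inner_le_neg_of_inner_neg {d : ℕ} {b : State d → State d} (hb : Continuous b)
    {z : State d} {η R : ℝ}
    (hz : ∀ p, η ≤ ‖p - z‖ → ‖p - z‖ ≤ R → inner ℝ (p - z) (b p - b z) < 0) :
    ∃ c > 0, ∃ κ > 0, ∀ p e : State d, η ≤ ‖p - z‖ → ‖p - z‖ ≤ R → ‖e‖ ≤ κ →
      inner ℝ (p - z) (b (p + e) - b z) ≤ -c := by
  let K : Set (State d) := {p | η ≤ ‖p - z‖} ∩ Metric.closedBall z R
  have hK : IsCompact K :=
    (isCompact_closedBall z R).inter_left (isClosed_le continuous_const (by fun_prop))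
  -- This form also gives a positive `a` when the annulus is empty.
  obtain ⟨a, ha, haK⟩ := hK.exists_forall_le' (f := fun p => -inner ℝ (p - z) (b p - b z)) (a := 0)
    (by fun_prop) fun p hp => neg_pos.2 (hz p hp.1 (mem_closedBall_iff_norm.1 hp.2))
  have hev : ∀ᶠ e in 𝓝 (0 : State d), ∀ p ∈ K, inner ℝ (p - z) (b (p + e) - b z) < -(a / 2) := by
    refine hK.eventually_forall_of_forall_eventually fun p hp => ?_
    have hcont : Continuous fun q : State d × State d =>
        inner ℝ (q.2 - z) (b (q.2 + q.1) - b z) := by fun_prop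
    refine hcont.continuousAt.eventually_lt continuousAt_const ?_
    have := haK p hp
    simp only [add_zero]
    linarith
  obtain ⟨κ, hκ, hκK⟩ := Metric.eventually_nhds_iff.1 hev
  refine ⟨a / 2, half_pos ha, κ / 2, half_pos hκ, fun p e h1 h2 he => (hκK ?_ p ?_).le⟩
  · rw [dist_zero_right]; linarith
  · exact ⟨h1, mem_closedBall_iff_norm.2 h2⟩

/-! ### From noise events to the flow -/

namespace IsRDSOfSDE

variable {d : ℕ} {P : Measure (PathSpace d)} {b : State d → State d} {σ : ℝ}
  {φ : ℝ≥0 → PathSpace d → State d → Option (State d)}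

theorem measure_image_near_translate_pos (hφ : IsRDSOfSDE P b σ φ) (hP : IsWienerMeasure P)
    (hb : Continuous b) (hσ : 0 < σ) (x : State d) (r : ℝ) {δ : ℝ} (z : State d) (hδ : 0 < δ) :
    ∃ T₀ : ℝ≥0, 0 < T₀ ∧ ∀ t₀ : ℝ≥0, 0 < t₀ → t₀ ≤ T₀ →
      0 < P {ω | ∀ x' ∈ Metric.ball x r, ∃ y ∈ Metric.ball (x' + z) δ, φ t₀ ω x' = some y} := by
  obtain ⟨M, hM⟩ := (isCompact_closedBall x (r + ‖z‖ + δ)).exists_bound_of_continuousOn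
    hb.continuousOn
  have hM1 : (0 : ℝ) < |M| + 1 := by positivity
  have hT : 0 < δ / 4 / (|M| + 1) := by positivity
  refine ⟨⟨_, hT.le⟩, hT, fun t₀ ht₀ htT => ?_⟩
  have ht₀' : (0 : ℝ) < t₀ := by exact_mod_cast ht₀
  have hMt : (|M| + 1) * t₀ ≤ δ / 4 := by
    rw [mul_comm]
    exact (le_div_iff₀ hM1).1 htT
  -- With this speed, `σ` times the noise has moved by about `z` at time `t₀`.
  refine (hP.measure_close_linear_pos ht₀ ((σ * t₀)⁻¹ • z)
    (show 0 < δ / 4 / σ by positivity)).trans_le (measure_mono_ae ?_)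
  filter_upwards [hφ.solves] with ω hsol hω x' hx'
  refine (hsol x').exists_mem_ball_of_noise_near hb
    (hφ.isLocalRDS.domain_mono ω x') ht₀ hδ (M := |M|) (fun y hy => ?_) hMt fun s hs => ?_
  · refine (hM y (mem_closedBall_iff_norm.2 ?_)).trans (le_abs_self M)
    have := mem_ball_iff_norm.1 hx'
    calc ‖y - x‖ = ‖(y - x') + (x' - x)‖ := by congr 1; abel
      _ ≤ ‖y - x'‖ + ‖x' - x‖ := norm_add_le _ _
      _ ≤ r + ‖z‖ + δ := by linarith
  · have h1 : σ • (ω s - ω 0) - ((s : ℝ) / t₀) • z =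
        σ • (ω s - ω 0 - (s : ℝ) • (σ * t₀)⁻¹ • z) := by
      rw [smul_sub σ (ω s - ω 0), smul_smul, smul_smul]
      congr 2
      field_simp
    rw [h1, norm_smul, Real.norm_of_nonneg hσ.le, mul_comm]
    exact (le_div_iff₀ hσ).1 (hω s hs)

/-- Translation by `y - x` with error `r` sends `B(x, r)` into `B(y, 2r)`. -/
theorem swiftTransitive (hφ : IsRDSOfSDE P b σ φ) (hP : IsWienerMeasure P) (hb : Continuous b)
    (hσ : 0 < σ) : SwiftTransitive P φ := by
  intro x r hr y
  obtain ⟨T₀, hT₀, h⟩ := hφ.measure_image_near_translate_pos hP hb hσ x r (y - x) hr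
  refine ⟨T₀, hT₀, (h T₀ hT₀ le_rfl).trans_le (measure_mono fun ω hω => ?_)⟩
  rintro _ ⟨x', hx', rfl⟩
  obtain ⟨y', hy', heq⟩ := hω x' hx'
  refine ⟨y', ?_, heq.symm⟩
  rw [mem_ball_iff_norm] at *
  calc ‖y' - y‖ = ‖(y' - (x' + (y - x))) + (x' - x)‖ := by congr 1; abel
    _ ≤ ‖y' - (x' + (y - x))‖ + ‖x' - x‖ := norm_add_le _ _
    _ < 2 * r := by linarith

theorem contractingOnLargeSets (hφ : IsRDSOfSDE P b σ φ) (hP : IsWienerMeasure P)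
    (hb : Continuous b) (hσ : 0 < σ) (hmon : MonotoneOnLargeSets b) :
    ContractingOnLargeSets P φ := by
  intro R hR
  -- Radius `3 * R` leaves room for the closed ball of radius `2 * R` on which the barrier argument
  -- runs. Taking `η = R / 16` and noise error at most `R / 16` puts the image within `R / 8` of
  -- `z`, hence the diameter `R / 4`.
  obtain ⟨z, hz⟩ := hmon (3 * R) (by positivity)
  obtain ⟨c, hc, κ, hκ, hF⟩ := exists_inner_le_neg_of_inner_neg hb (z := z) (η := R / 16)
    (R := 2 * R) fun p hp hpR => by
      rw [real_inner_comm]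
      refine hz p (mem_ball_iff_norm.2 (by linarith)) z (Metric.mem_ball_self (by positivity)) ?_
      rintro rfl
      rw [sub_self, norm_zero] at hp
      linarith
  have hκ' : 0 < min κ (R / 16) := lt_min hκ (by positivity)
  have ht : 0 < R ^ 2 / c := by positivity
  let t₀ : ℝ≥0 := ⟨R ^ 2 / c, ht.le⟩
  have ht₀ : (t₀ : ℝ) = R ^ 2 / c := rfl
  refine ⟨z, t₀, ht, ?_⟩
  refine (hP.measure_close_linear_pos (T := t₀) ht (-(σ⁻¹ • b z))
    (show 0 < min κ (R / 16) / σ by positivity)).trans_le (measure_mono_ae ?_)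
  filter_upwards [hφ.solves] with ω hsol hω
  have key : ∀ x ∈ Metric.ball z R, ∃ y, ‖y - z‖ ≤ R / 8 ∧ φ t₀ ω x = some y := by
    intro x hx
    obtain ⟨y, hy, heq⟩ := (hsol x).exists_near_of_noise_near hb
      (hφ.isLocalRDS.domain_mono ω x) (t₀ := t₀) (R := R) (η := R / 16) (κ := min κ (R / 16))
      (by positivity) (by linarith) hc (by rw [ht₀, mul_div_cancel₀ _ hc.ne'])
      (mem_ball_iff_norm.1 hx).le
      (fun p e h1 h2 h3 => hF p e h1 h2 (h3.trans (min_le_left _ _))) fun s hs => by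
        have h1 : σ • (ω s - ω 0) + (s : ℝ) • b z =
            σ • (ω s - ω 0 - (s : ℝ) • -(σ⁻¹ • b z)) := by
          rw [smul_neg, sub_neg_eq_add, smul_add, smul_comm σ (s : ℝ), smul_inv_smul₀ hσ.ne']
        rw [h1, norm_smul, Real.norm_of_nonneg hσ.le, mul_comm]
        exact (le_div_iff₀ hσ).1 (hω s hs)
    exact ⟨y, hy.trans (by linarith [min_le_right κ (R / 16)]), heq⟩
  refine ⟨{y | ∃ x ∈ Metric.ball z R, φ t₀ ω x = some y}, ?_, ?_⟩
  · ext o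
    constructor
    · rintro ⟨x, hx, rfl⟩
      obtain ⟨y, -, hy⟩ := key x hx
      exact ⟨y, ⟨x, hx, hy⟩, hy.symm⟩
    · rintro ⟨y, ⟨x, hx, hy⟩, rfl⟩
      exact ⟨x, hx, hy⟩
  · refine Metric.ediam_le_of_forall_dist_le ?_
    rintro y ⟨x, hx, hy⟩ y' ⟨x', hx', hy'⟩
    obtain ⟨p, hp, hpe⟩ := key x hx
    obtain ⟨p', hp', hpe'⟩ := key x' hx'
    obtain rfl := Option.some_injective _ (hy.symm.trans hpe)
    obtain rfl := Option.some_injective _ (hy'.symm.trans hpe')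
    have := dist_triangle_right y y' z
    rw [dist_eq_norm y z, dist_eq_norm y' z] at this
    linarith

end IsRDSOfSDE

theorem mainTheorem8 (d : ℕ) (b : State d → State d) (hb : LocallyLipschitz b)
    (σ : ℝ) (hσ : 0 < σ) (P : Measure (PathSpace d)) (hP : IsWienerMeasure P)
    (φ : ℝ≥0 → PathSpace d → State d → Option (State d)) (hφ : IsRDSOfSDE P b σ φ) :
    (∀ (x : State d) (r δ : ℝ) (z : State d), 0 < r → 0 < δ →
      ∃ T₀ : ℝ≥0, 0 < T₀ ∧ ∀ t₀ : ℝ≥0, 0 < t₀ → t₀ ≤ T₀ →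
        0 < P {ω | ∀ x' ∈ Metric.ball x r,
          ∃ y ∈ Metric.ball (x' + z) δ, φ t₀ ω x' = some y}) ∧
    SwiftTransitive P φ ∧
    (MonotoneOnLargeSets b → ContractingOnLargeSets P φ) :=
  ⟨fun x r _ z _ hδ => hφ.measure_image_near_translate_pos hP hb.continuous hσ x r z hδ,
    hφ.swiftTransitive hP hb.continuous hσ, hφ.contractingOnLargeSets hP hb.continuous hσ⟩
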